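/- Let $m\ge 2$ be an integer and $\mathcal T=\{0,\frac1{m-1},\dots,\frac{m-2}{m-1},1\}$, with $a\to b=\min\{1,1-a+b\}$ and $a\odot b=\max\{0,a+b-1\}$. Formulae are built from a denumerable set of propositional variables by a unary connective $\neg$ and binary connectives $\to$ (Łukasiewicz implication) and $\succ$ (conditional). Put $\mathbf t:=p\to p$ for a fixed variable $p$, $\varphi\vee\psi:=(\varphi\to\psi)\to\psi$, $\varphi\wedge\psi:=\neg(\neg\varphi\vee\neg\psi)$, $\varphi\odot\psi:=\neg(\varphi\to\neg\psi)$, $\varphi\leftrightarrow\psi:=(\varphi\to\psi)\wedge(\psi\to\varphi)$; let $\varphi^{n}$ be the $n$-fold product $\varphi\odot\cdots\odot\varphi$ (bracketed to the left), and let $\to_{i=1}^{k}(\varphi_i,\psi)$ be $\varphi_k\to(\cdots\to(\varphi_1\to\psi)\cdots)$. For $a\in\mathcal T$ the formula $\mathbf J_a(\varphi)$ is defined by $\mathbf J_1(\varphi):=\varphi^{m-1}$; for $\frac12\le a<1$, with $n$ the largest integer such that $n(1-a)<1$, $$\mathbf J_a(\varphi):=\begin{cases}\mathbf J_1(\neg\varphi^{n}\leftrightarrow\varphi)&\text{if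 } n(1-a)=a,\\ \mathbf J_{n(1-a)}(\neg\varphi^{n})&\text{if } n(1-a)>a;\end{cases}$$ and $\mathbf J_a(\varphi):=\mathbf J_{1-a}(\neg\varphi)$ for $a<\frac12$. Moreover, $\mathbf I_a(\varphi)$ is the disjunction (bracketed to the right) of the $\mathbf J_b(\varphi)$ over $b\in\mathcal T$, $b\ge a$, in increasing order of $b$. The $m$-valued conditional logic $\mathbf{LCR}$ is the least set of formulae that contains all instances (for all formulae $\varphi,\psi,\theta$ and all $a,b\in\mathcal T$) of - the axioms of Łukasiewicz $m$-valued propositional logic (in the axiomatization of Rosser and Turquette): $\varphi\to(\psi\to\varphi)$; $(\varphi\to(\psi\to\theta))\to(\psi\to(\varphi\to\theta))$; $(\varphi\to\psi)\to((\psi\to\theta)\to(\varphi\to\theta))$; $(\mathbf J_a(\varphi)\to(\mathbf J_a(\varphi)\to\psi))\to(\mathbf J_a(\varphi)\to\psi)$; $\to_{i=1}^{m}(\mathbf J_{\frac{i-1}{m-1}}(\varphi)\to\psi,\ \psi)$; $\mathbf J_1(\varphi)\to\varphi$; $\mathbf J_a(\varphi)\to\mathbf J_{1-a}(\neg\varphi)$;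 $\mathbf J_a(\varphi)\to(\mathbf J_b(\psi)\to\mathbf J_{a\to b}(\varphi\to\psi))$; - the axioms for conditionals: $(\varphi\succ(\psi\wedge\theta))\to((\varphi\succ\psi)\wedge(\varphi\succ\theta))$; $((\varphi\succ\psi)\wedge(\varphi\succ\theta))\to(\varphi\succ(\psi\wedge\theta))$; $\varphi\succ\mathbf t$; and is closed under the rules - modus ponens: from $\varphi\to\psi$ and $\varphi$ infer $\psi$; - from $\varphi\leftrightarrow\psi$ infer $(\varphi\succ\theta)\leftrightarrow(\psi\succ\theta)$; - from $\varphi\leftrightarrow\psi$ infer $(\theta\succ\varphi)\leftrightarrow(\theta\succ\psi)$; - for $a\in\mathcal T$ and $a_i=\frac{m-i}{m-1}$ ($1\le i\le m$): from $\to_{i=1}^{m}(\mathbf I_{a_i\odot b}(\gamma_i),\mathbf I_{a\odot b}(\gamma))$ for every $b\in\mathcal T$ infer $\to_{i=1}^{m}(\mathbf I_{a_i}(\varphi\succ\gamma_i),\mathbf I_a(\varphi\succ\gamma))$. Then, for every $m\ge2$, $\mathbf{LCR}$ is decidable: there is an algorithm that decides, given (the Gödel number of) a formula $\varphi$, whether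 $\varphi$ is a theorem of $\mathbf{LCR}$. -/

import Mathlib

namespace LCR

/-- Formulae of the conditional language: a denumerable set of propositional variables
`p₀, p₁, …`, negation `¬`, implication `→` and the conditional `≻`. -/
inductive Formula : Type
  | var : ℕ → Formula
  | neg : Formula → Formula
  | imp : Formula → Formula → Formula
  | condl : Formula → Formula → Formula
  deriving DecidableEq

namespace Formula

/-! ### Effective coding of formulae, needed to speak of computability -/

/-- The Gödel number of a formula (`Nat.pair` is Mathlib's computable pairing bijection). -/
def code : Formula → ℕ
  | var n => 4 * n
  | neg φ => 4 * code φ + 1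
  | imp φ ψ => 4 * Nat.pair (code φ) (code ψ) + 2
  | condl φ ψ => 4 * Nat.pair (code φ) (code ψ) + 3

/-- The formula with a given Gödel number. -/
def ofCode (n : ℕ) : Formula :=
  if h0 : n % 4 = 0 then var (n / 4)
  else if n % 4 = 1 then neg (ofCode (n / 4))
  else if n % 4 = 2 then imp (ofCode (n / 4).unpair.1) (ofCode (n / 4).unpair.2)
  else condl (ofCode (n / 4).unpair.1) (ofCode (n / 4).unpair.2)
termination_by n
decreasing_by
  all_goals
    have h1 := Nat.unpair_left_le (n / 4)
    have h2 := Nat.unpair_right_le (n / 4)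
    omega

theorem ofCode_code (φ : Formula) : ofCode (code φ) = φ := by
  induction φ with
  | var n =>
    rw [code, ofCode, dif_pos (by omega)]
    congr 1; omega
  | neg φ ih =>
    have h : (4 * code φ + 1) / 4 = code φ := by omega
    rw [code, ofCode, dif_neg (by omega), if_pos (by omega), h, ih]
  | imp φ ψ ih₁ ih₂ =>
    have h : (4 * Nat.pair (code φ) (code ψ) + 2) / 4 = Nat.pair (code φ) (code ψ) := by omega
    rw [code, ofCode, dif_neg (by omega), if_neg (by omega), if_pos (by omega), h,
      Nat.unpair_pair, ih₁, ih₂]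
  | condl φ ψ ih₁ ih₂ =>
    have h : (4 * Nat.pair (code φ) (code ψ) + 3) / 4 = Nat.pair (code φ) (code ψ) := by omega
    rw [code, ofCode, dif_neg (by omega), if_neg (by omega), if_neg (by omega), h,
      Nat.unpair_pair, ih₁, ih₂]

theorem code_ofCode (n : ℕ) : code (ofCode n) = n := by
  induction n using Nat.strong_induction_on with
  | _ n ih =>
    have h1 := Nat.unpair_left_le (n / 4)
    have h2 := Nat.unpair_right_le (n / 4)
    rw [ofCode]
    split_ifs with c0 c1 c2
    · rw [code]; omega
    · rw [code, ih _ (by omega)]; omega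
    · rw [code, ih _ (by omega), ih _ (by omega), Nat.pair_unpair]; omega
    · rw [code, ih _ (by omega), ih _ (by omega), Nat.pair_unpair]; omega

/-- Gödel numbering as a bijection between formulae and natural numbers. -/
def codeEquiv : Formula ≃ ℕ := ⟨code, ofCode, ofCode_code, code_ofCode⟩

/-- Computability of predicates of formulae is computability in terms of Gödel numbers. -/
instance : Primcodable Formula := Primcodable.ofEquiv ℕ codeEquiv

/-! ### Defined connectives -/

/-- `𝐭 := p → p`, for a fixed variable `p`. -/
def tt : Formula := imp (var 0) (var 0)

/-- `φ ∨ ψ := (φ → ψ) → ψ`. -/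
def disj (φ ψ : Formula) : Formula := imp (imp φ ψ) ψ

/-- `φ ∧ ψ := ¬(¬φ ∨ ¬ψ)`. -/
def conj (φ ψ : Formula) : Formula := neg (disj (neg φ) (neg ψ))

/-- `φ ⊙ ψ := ¬(φ → ¬ψ)`. -/
def odot (φ ψ : Formula) : Formula := neg (imp φ (neg ψ))

/-- `φ ↔ ψ := (φ → ψ) ∧ (ψ → φ)`. -/
def bimp (φ ψ : Formula) : Formula := conj (imp φ ψ) (imp ψ φ)

/-- The nested implication `→_{i=1}^k (φ_i, ψ)`, that is `φ_k → (… → (φ_1 → ψ))`. -/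
def impChain (f : ℕ → Formula) (ψ : Formula) : ℕ → Formula
  | 0 => ψ
  | k + 1 => imp (f (k + 1)) (impChain f ψ k)

/-- The `n`-fold product `φ ⊙ … ⊙ φ`, bracketed to the left (used only for `n ≥ 1`). -/
def power (φ : Formula) : ℕ → Formula
  | 0 => tt
  | 1 => φ
  | n + 2 => odot (power φ (n + 1)) φ

/-- `J_1(φ)`: the `(m-1)`-fold product of `φ` with itself. -/
def J₁ (m : ℕ) (φ : Formula) : Formula := power φ (m - 1)

/-- The formula `J_a(φ)` for the truth value `a = i / (m - 1)`, given by its numerator `i`.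
For `1/2 ≤ a < 1`, with `d = (m - 1) - i` the numerator of `1 - a`, the number
`n = (m - 2) / d` is the largest `n` such that `n * (1 - a) < 1`; the case distinction
`n = a / (1 - a)` or `n > a / (1 - a)` reads `n * d = i` or `n * d > i`. -/
def J (m i : ℕ) (φ : Formula) : Formula :=
  if m - 1 ≤ i then J₁ m φ
  else if 2 * i < m - 1 then J m (m - 1 - i) (neg φ)
  else if (m - 2) / (m - 1 - i) * (m - 1 - i) = i then
    J₁ m (bimp (neg (power φ ((m - 2) / (m - 1 - i)))) φ)
  else J m ((m - 2) / (m - 1 - i) * (m - 1 - i)) (neg (power φ ((m - 2) / (m - 1 - i))))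
termination_by m - 1 - i
decreasing_by
  · omega
  · have hd : 0 < m - 1 - i := by omega
    have h1 := Nat.div_add_mod (m - 2) (m - 1 - i)
    have h2 := Nat.mod_lt (m - 2) hd
    rw [Nat.mul_comm] at h1
    omega

/-- `J_{(m-1-k)/(m-1)}(φ) ∨ (… ∨ (J_{(m-2)/(m-1)}(φ) ∨ J_1(φ)))`. -/
def disjJ (m : ℕ) (φ : Formula) : ℕ → Formula
  | 0 => J m (m - 1) φ
  | k + 1 => disj (J m (m - 1 - (k + 1)) φ) (disjJ m φ k)

/-- `I_a(φ) := J_a(φ) ∨ … ∨ J_1(φ)`, the disjunction of the `J_b(φ)` over all truth values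
`b ≥ a`, for `a = i / (m - 1)`. -/
def I (m i : ℕ) (φ : Formula) : Formula := disjJ m φ (m - 1 - i)

end Formula

/-! ### Operations on truth values

The truth value set is `{0, 1/(m-1), …, (m-2)/(m-1), 1}`; the value `i / (m - 1)` is given by
its numerator `i ≤ m - 1`. -/

/-- Numerator of `a → b = min (1, 1 - a + b)`. -/
def vimp (m a b : ℕ) : ℕ := min (m - 1) (m - 1 - a + b)

/-- Numerator of `a ⊙ b = max (0, a + b - 1)` (truncated subtraction). -/
def vodot (m a b : ℕ) : ℕ := a + b - (m - 1)

open Formula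

/-- The theorems of `m`-valued **LCR**. The constructors up to `mp` are the axiom schemata and
the rule of the Rosser–Turquette axiomatization of Łukasiewicz `m`-valued propositional logic
(for all formulae of the conditional language); the other ones are the axiom schemata and the
rules for conditionals. -/
inductive Provable (m : ℕ) : Formula → Prop
  | weak (φ ψ : Formula) : Provable m (imp φ (imp ψ φ))
  | perm (φ ψ θ : Formula) :
      Provable m (imp (imp φ (imp ψ θ)) (imp ψ (imp φ θ)))
  | syll (φ ψ θ : Formula) :
      Provable m (imp (imp φ ψ) (imp (imp ψ θ) (imp φ θ)))
  /-- `(J_a(φ) → (J_a(φ) → ψ)) → (J_a(φ) → ψ)` -/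
  | contr (a : ℕ) (ha : a ≤ m - 1) (φ ψ : Formula) :
      Provable m (imp (imp (J m a φ) (imp (J m a φ) ψ)) (imp (J m a φ) ψ))
  /-- `→_{i=1}^m (J_{(i-1)/(m-1)}(φ) → ψ, ψ)` -/
  | cases (φ ψ : Formula) :
      Provable m (impChain (fun i => imp (J m (i - 1) φ) ψ) ψ m)
  /-- `J_1(φ) → φ` -/
  | desig (φ : Formula) : Provable m (imp (J m (m - 1) φ) φ)
  /-- `J_a(φ) → J_{1-a}(¬φ)` -/
  | table_neg (a : ℕ) (ha : a ≤ m - 1) (φ : Formula) :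
      Provable m (imp (J m a φ) (J m (m - 1 - a) (neg φ)))
  /-- `J_a(φ) → (J_b(ψ) → J_{a→b}(φ → ψ))` -/
  | table_imp (a b : ℕ) (ha : a ≤ m - 1) (hb : b ≤ m - 1) (φ ψ : Formula) :
      Provable m (imp (J m a φ) (imp (J m b ψ) (J m (vimp m a b) (imp φ ψ))))
  | mp {φ ψ : Formula} (h₁ : Provable m (imp φ ψ)) (h₂ : Provable m φ) : Provable m ψ
  | cm (φ ψ θ : Formula) :
      Provable m (imp (condl φ (conj ψ θ)) (conj (condl φ ψ) (condl φ θ)))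
  | cc (φ ψ θ : Formula) :
      Provable m (imp (conj (condl φ ψ) (condl φ θ)) (condl φ (conj ψ θ)))
  | cn (φ : Formula) : Provable m (condl φ tt)
  | rcea {φ ψ : Formula} (θ : Formula) (h : Provable m (bimp φ ψ)) :
      Provable m (bimp (condl φ θ) (condl ψ θ))
  | rcec {φ ψ : Formula} (θ : Formula) (h : Provable m (bimp φ ψ)) :
      Provable m (bimp (condl θ φ) (condl θ ψ))
  /-- From `→_{i=1}^m (I_{a_i ⊙ b}(γ_i), I_{a ⊙ b}(γ))` for every truth value `b`, infer
  `→_{i=1}^m (I_{a_i}(φ ≻ γ_i), I_a(φ ≻ γ))`, where `a_i = (m-i)/(m-1)`. -/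
  | ra (a : ℕ) (ha : a ≤ m - 1) (φ γ : Formula) (γs : ℕ → Formula)
      (h : ∀ b : ℕ, b ≤ m - 1 →
        Provable m (impChain (fun i => I m (vodot m (m - i) b) (γs i)) (I m (vodot m a b) γ) m)) :
      Provable m (impChain (fun i => I m (m - i) (condl φ (γs i))) (I m a (condl φ γ)) m)

end LCR

/-! The logic has the finite model property with a computable bound, so a bounded search for a
countermodel decides theoremhood.

Points of models are `m`-valued assignments, and each `m`-valued proposition `X` carries its own
`m`-valued accessibility relation; `φ ≻ ψ` takes the infimum over all points `u` of `R_φ(w, u) →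
ψ(u)`. All theorems hold in such models (`eval_eq_top_of_provable`).

Conversely, a nontheorem fails under some canonical valuation, one that designates every theorem
(`provable_iff_canonical`). This is a Lindenbaum construction: run through all formulae and fix a
truth value for each while the nontheorem stays underivable. Given a nontheorem with code `N - 1`,
restrict all canonical valuations to formulae of code less than `N`. This set of formulae is closed
under subformulae, so there are at most `m ^ N` points, and the rule for conditionals provides the
points that witness the values of conditionals (`IsCanonical.lt_condl`).

A set of assignments is a number below `2 ^ (m ^ N)`. Being a model and refuting a formula involve
only bounded quantifiers over arithmetic of digits, so `Refutable` is primitive recursive; it is the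
complement of theoremhood on codes. -/

namespace LCR

open Formula

/-! ### Łukasiewicz valuations and the meaning of `J` and `I` -/

/-- Valuations in the `m`-valued Łukasiewicz chain (values are given by their numerators). -/
structure IsVal (m : ℕ) (v : Formula → ℕ) : Prop where
  le : ∀ φ, v φ ≤ m - 1
  neg : ∀ φ, v (neg φ) = m - 1 - v φ
  imp : ∀ φ ψ, v (imp φ ψ) = vimp m (v φ) (v ψ)

namespace IsVal

variable {m : ℕ} {v : Formula → ℕ}

theorem imp_eq_top (hv : IsVal m v) (φ ψ : Formula) : v (.imp φ ψ) = m - 1 ↔ v φ ≤ v ψ := by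
  have h1 := hv.le φ
  have h2 := hv.le ψ
  rw [hv.imp, vimp]; omega

theorem tt (hv : IsVal m v) : v tt = m - 1 := by
  rw [Formula.tt, hv.imp_eq_top]

theorem disj (hv : IsVal m v) (φ ψ : Formula) : v (disj φ ψ) = max (v φ) (v ψ) := by
  have h1 := hv.le φ
  have h2 := hv.le ψ
  simp only [Formula.disj, hv.imp, vimp]; omega

theorem conj (hv : IsVal m v) (φ ψ : Formula) : v (conj φ ψ) = min (v φ) (v ψ) := by
  have h1 := hv.le φ
  have h2 := hv.le ψ
  simp only [Formula.conj, hv.neg, hv.disj]; omega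

theorem odot (hv : IsVal m v) (φ ψ : Formula) : v (odot φ ψ) = v φ + v ψ - (m - 1) := by
  have h1 := hv.le φ
  have h2 := hv.le ψ
  simp only [Formula.odot, hv.neg, hv.imp, vimp]; omega

theorem bimp_eq_top (hv : IsVal m v) (φ ψ : Formula) : v (bimp φ ψ) = m - 1 ↔ v φ = v ψ := by
  have h1 := hv.le φ
  have h2 := hv.le ψ
  simp only [Formula.bimp, hv.conj, hv.imp, vimp]; omega

theorem power (hv : IsVal m v) (φ : Formula) (n : ℕ) :
    v (power φ (n + 1)) = (n + 1) * v φ - n * (m - 1) := by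
  induction n with
  | zero => simp [Formula.power]
  | succ n ih =>
    rw [Formula.power, hv.odot, ih]
    have h1 := hv.le φ
    have h2 : n * v φ ≤ n * (m - 1) := Nat.mul_le_mul_left n h1
    simp only [Nat.succ_mul]
    omega

theorem neg_power (hv : IsVal m v) (φ : Formula) {n : ℕ} (hn : 0 < n) :
    v (.neg (Formula.power φ n)) = min (m - 1) (n * (m - 1 - v φ)) := by
  obtain ⟨n, rfl⟩ : ∃ k, n = k + 1 := ⟨n - 1, by omega⟩
  have h1 := hv.le φ
  have h2 : n * v φ ≤ n * (m - 1) := Nat.mul_le_mul_left n h1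
  have h3 : n * (m - 1 - v φ) = n * (m - 1) - n * v φ := Nat.mul_sub _ _ _
  rw [hv.neg, hv.power]
  simp only [Nat.succ_mul, h3]
  omega

theorem iterate_imp (hv : IsVal m v) (φ ψ : Formula) (k : ℕ) :
    v ((Formula.imp φ)^[k] ψ) = min (m - 1) (k * (m - 1 - v φ) + v ψ) := by
  have h1 := hv.le φ
  have h2 := hv.le ψ
  induction k with
  | zero => simp [h2]
  | succ k ih =>
    rw [Function.iterate_succ_apply', hv.imp, ih, vimp, Nat.succ_mul]
    omega

theorem J₁ (hm : 2 ≤ m) (hv : IsVal m v) (φ : Formula) :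
    v (J₁ m φ) = if v φ = m - 1 then m - 1 else 0 := by
  obtain ⟨k, rfl⟩ : ∃ k, m = k + 2 := ⟨m - 2, by omega⟩
  have h1 := hv.le φ
  rw [Formula.J₁, show k + 2 - 1 = k + 1 by omega, hv.power, show k + 2 - 1 = k + 1 by omega]
  rw [show k + 2 - 1 = k + 1 by omega] at h1
  split_ifs with h
  · rw [h, Nat.add_mul]; omega
  · have h2 : (k + 1) * v φ ≤ (k + 1) * k := Nat.mul_le_mul_left _ (by omega)
    rw [Nat.mul_comm k]; omega

/-- Follows the recursion defining `J`. With `c` and `d` the distances of `v φ` and `i` from the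
top, `¬φ^n` has value `min (m - 1) (n * c)`, and the chosen `n` satisfies `n * d < m - 1`, so
truncation does not interfere at `c = d`. -/
theorem J (hm : 2 ≤ m) (hv : IsVal m v) {i : ℕ} (hi : i ≤ m - 1) (φ : Formula) :
    v (J m i φ) = if v φ = i then m - 1 else 0 := by
  induction hk : m - 1 - i using Nat.strong_induction_on generalizing i φ with
  | _ k ih =>
    have hx := hv.le φ
    rw [Formula.J]
    split_ifs with h1 h2 h3 h4 h5 h5
    · rw [hv.J₁ hm, if_pos (by omega)]
    · rw [hv.J₁ hm, if_neg (by omega)]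
    · rw [ih _ (by omega) (by omega) _ rfl, hv.neg, if_pos (by omega)]
    · rw [ih _ (by omega) (by omega) _ rfl, hv.neg, if_neg (by omega)]
    all_goals
      have hd : 0 < m - 1 - i := by omega
      have e1 := Nat.div_add_mod (m - 2) (m - 1 - i)
      have e2 := Nat.mod_lt (m - 2) hd
      have hn : 0 < (m - 2) / (m - 1 - i) := Nat.div_pos (by omega) hd
      rw [Nat.mul_comm] at e1
      generalize (m - 2) / (m - 1 - i) = n at *
      generalize hc : m - 1 - v φ = c
      generalize hd' : m - 1 - i = d at *
    · rw [hv.J₁ hm]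
      have : c = d := by omega
      subst this
      rw [if_pos]
      rw [hv.bimp_eq_top, hv.neg_power _ hn, hc]; omega
    · rw [hv.J₁ hm, if_neg]
      rw [hv.bimp_eq_top, hv.neg_power _ hn, hc]
      intro h
      -- In `c`, the value of `¬φ^n` is nondecreasing and that of `φ` is strictly decreasing, so
      -- they agree only at `c = d`.
      rcases lt_or_gt_of_ne (show c ≠ d by omega) with h' | h'
      · have := Nat.mul_le_mul_left n h'.le
        omega
      · have := Nat.mul_le_mul_left n h'.le
        omega
    · have : c = d := by omega
      subst this
      rw [ih _ (by omega) (by omega) _ rfl, hv.neg_power _ hn, hc, if_pos (by omega)]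
    · rw [ih _ (by omega) (by omega) _ rfl, hv.neg_power _ hn, hc, if_neg]
      have : n * c ≠ n * d := fun h => (show c ≠ d by omega) (Nat.eq_of_mul_eq_mul_left hn h)
      omega

theorem disjJ (hm : 2 ≤ m) (hv : IsVal m v) (φ : Formula) {k : ℕ} (hk : k ≤ m - 1) :
    v (disjJ m φ k) = if m - 1 - k ≤ v φ then m - 1 else 0 := by
  have h1 := hv.le φ
  induction k with
  | zero =>
    rw [Formula.disjJ, hv.J hm le_rfl]
    split_ifs <;> omega
  | succ k ih =>
    rw [Formula.disjJ, hv.disj, hv.J hm (by omega), ih (by omega)]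
    split_ifs <;> omega

theorem I (hm : 2 ≤ m) (hv : IsVal m v) {i : ℕ} (hi : i ≤ m - 1) (φ : Formula) :
    v (I m i φ) = if i ≤ v φ then m - 1 else 0 := by
  rw [Formula.I, hv.disjJ hm φ (by omega), show m - 1 - (m - 1 - i) = i by omega]

theorem impChain_I (hm : 2 ≤ m) (hv : IsVal m v) {f : ℕ → ℕ} {c : ℕ} (hc : c ≤ m - 1)
    (g : ℕ → Formula) (χ : Formula) {k : ℕ} (hf : ∀ i, 1 ≤ i → i ≤ k → f i ≤ m - 1) :
    v (impChain (fun i => Formula.I m (f i) (g i)) (Formula.I m c χ) k) =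
      if (∀ i, 1 ≤ i → i ≤ k → f i ≤ v (g i)) → c ≤ v χ then m - 1 else 0 := by
  classical
  induction k with
  | zero =>
    rw [impChain, hv.I hm hc]
    exact if_congr ⟨fun h _ => h, fun h => h (by intros; omega)⟩ rfl rfl
  | succ k ih =>
    rw [impChain, hv.imp, hv.I hm (hf _ (by omega) le_rfl), ih fun i h1 h2 => hf i h1 (by omega)]
    by_cases h : f (k + 1) ≤ v (g (k + 1))
    · rw [if_pos h, vimp]
      have : (∀ i, 1 ≤ i → i ≤ k + 1 → f i ≤ v (g i)) ↔ ∀ i, 1 ≤ i → i ≤ k → f i ≤ v (g i) := by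
        refine ⟨fun H i h1 h2 => H i h1 (by omega), fun H i h1 h2 => ?_⟩
        rcases Nat.lt_or_ge k i with h3 | h3
        · obtain rfl : i = k + 1 := by omega
          exact h
        · exact H i h1 h3
      simp only [this]
      split_ifs <;> omega
    · rw [if_neg h, vimp, if_pos (fun H => absurd (H (k + 1) (by omega) (Nat.le_refl _)) h :
        (∀ i, 1 ≤ i → i ≤ k + 1 → f i ≤ v (g i)) → c ≤ v χ)]
      omega

end IsVal

/-! ### Derivations from hypotheses -/

/-- Derivability of a formula from hypotheses, with modus ponens as the only rule that may use
the hypotheses. -/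
inductive Der (m : ℕ) (Γ : Set Formula) : Formula → Prop
  | hyp {φ : Formula} (h : φ ∈ Γ) : Der m Γ φ
  | thm {φ : Formula} (h : Provable m φ) : Der m Γ φ
  | mp {φ ψ : Formula} (h₁ : Der m Γ (imp φ ψ)) (h₂ : Der m Γ φ) : Der m Γ ψ

variable {m : ℕ}

theorem Provable.swap {φ ψ θ : Formula} (h : Provable m (imp φ (imp ψ θ))) :
    Provable m (imp ψ (imp φ θ)) := (Provable.perm φ ψ θ).mp h

theorem Provable.refl (φ : Formula) : Provable m (imp φ φ) :=
  (Provable.weak φ (imp φ (imp φ φ))).swap.mp (Provable.weak φ φ)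

namespace Der

variable {Γ Δ : Set Formula}

theorem mono (h : Γ ⊆ Δ) {φ : Formula} (hφ : Der m Γ φ) : Der m Δ φ := by
  induction hφ with
  | hyp h' => exact .hyp (h h')
  | thm h' => exact .thm h'
  | mp _ _ ih₁ ih₂ => exact .mp ih₁ ih₂

theorem provable {φ : Formula} (hφ : Der m ∅ φ) : Provable m φ := by
  induction hφ with
  | hyp h' => exact h'.elim
  | thm h' => exact h'
  | mp _ _ ih₁ ih₂ => exact .mp ih₁ ih₂

/-- Restricted to hypotheses `J_a(χ)` because contraction is an axiom only for these; it merges the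
two copies of the hypothesis that modus ponens creates. -/
theorem deduction {a : ℕ} (ha : a ≤ m - 1) {χ φ : Formula}
    (h : Der m (insert (J m a χ) Γ) φ) : Der m Γ (imp (J m a χ) φ) := by
  induction h with
  | @hyp φ h' =>
    rcases h' with rfl | h'
    · exact .thm (.refl _)
    · exact (Der.thm (.weak _ _)).mp (.hyp h')
  | thm h' => exact .thm ((Provable.weak _ _).mp h')
  | @mp φ ψ _ _ ih₁ ih₂ =>
    have h₃ := (Der.thm (.perm _ _ _)).mp ih₁
    have h₄ := ((Der.thm (.syll _ _ _)).mp ih₂).mp h₃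
    exact (Der.thm (.contr a ha χ ψ)).mp h₄

theorem of_impChain {f : ℕ → Formula} {ψ : Formula} {k : ℕ} (h : Der m Γ (impChain f ψ k))
    (hf : ∀ i, 1 ≤ i → i ≤ k → Der m Γ (f i)) : Der m Γ ψ := by
  induction k with
  | zero => exact h
  | succ k ih =>
    exact ih (h.mp (hf _ (by omega) le_rfl)) fun i h1 h2 => hf i h1 (by omega)

theorem of_iterate_imp {φ ψ : Formula} {k : ℕ} (h : Der m Γ ((imp φ)^[k] ψ)) (hφ : Der m Γ φ) :
    Der m Γ ψ := by
  induction k with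
  | zero => exact h
  | succ k ih =>
    rw [Function.iterate_succ_apply'] at h
    exact ih (h.mp hφ)

theorem by_cases (χ : Formula) {φ : Formula}
    (h : ∀ a ≤ m - 1, Der m (insert (J m a χ) Γ) φ) : Der m Γ φ :=
  of_impChain (.thm (.cases χ φ)) fun i _ _ => deduction (by omega) (h _ (by omega))

theorem exists_of_iUnion {G : ℕ → Set Formula} (hG : Monotone G) {φ : Formula}
    (h : Der m (⋃ n, G n) φ) : ∃ n, Der m (G n) φ := by
  induction h with
  | hyp h =>
    obtain ⟨n, hn⟩ := Set.mem_iUnion.1 h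
    exact ⟨n, .hyp hn⟩
  | thm h => exact ⟨0, .thm h⟩
  | mp _ _ ih₁ ih₂ =>
    obtain ⟨n₁, h₁⟩ := ih₁
    obtain ⟨n₂, h₂⟩ := ih₂
    exact ⟨max n₁ n₂, (h₁.mono (hG (le_max_left _ _))).mp (h₂.mono (hG (le_max_right _ _)))⟩

end Der

/-! ### Completeness by canonical valuations -/

/-- The valuation determined by values of the variables and of the conditional formulae. -/
def extend (m : ℕ) (a : Formula → ℕ) : Formula → ℕ
  | .var n => a (.var n)
  | .neg φ => m - 1 - extend m a φ
  | .imp φ ψ => vimp m (extend m a φ) (extend m a ψ)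
  | .condl φ ψ => a (.condl φ ψ)

theorem isVal_extend {a : Formula → ℕ} (ha : ∀ φ, a φ ≤ m - 1) : IsVal m (extend m a) where
  le φ := by
    cases φ <;> simp only [extend, vimp]
    · exact ha _
    · omega
    · omega
    · exact ha _
  neg _ := rfl
  imp _ _ := rfl

/-- Kalmár's lemma. -/
theorem Der.extend {a : Formula → ℕ} (ha : ∀ φ, a φ ≤ m - 1) {Γ : Set Formula}
    (hΓ : ∀ φ, J m (a φ) φ ∈ Γ) (φ : Formula) : Der m Γ (J m (extend m a φ) φ) := by
  have hle := (isVal_extend ha).le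
  induction φ with
  | var n => exact .hyp (hΓ _)
  | condl φ ψ => exact .hyp (hΓ _)
  | neg φ ih => exact (Der.thm (.table_neg _ (hle _) _)).mp ih
  | imp φ ψ ih₁ ih₂ => exact ((Der.thm (.table_imp _ _ (hle _) (hle _) _ _)).mp ih₁).mp ih₂

/-- By `Der.by_cases`, a set not deriving `θ` can be extended by `J_c(χ)` for some value `c` without
deriving `θ`. Do this along the enumeration of formulae; derivations are finite, so the union does
not derive `θ` either. -/
theorem exists_not_der {θ : Formula} (hθ : ¬ Provable m θ) :
    ∃ (a : Formula → ℕ) (Γ : Set Formula), (∀ φ, a φ ≤ m - 1) ∧ (∀ φ, J m (a φ) φ ∈ Γ) ∧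
      ¬ Der m Γ θ := by
  have step : ∀ (G : {Γ : Set Formula // ¬ Der m Γ θ}) (χ : Formula),
      ∃ c ≤ m - 1, ¬ Der m (insert (J m c χ) G.1) θ := by
    intro G χ
    by_contra! h
    exact G.2 (Der.by_cases χ h)
  choose c hc hcG using step
  let G : ℕ → {Γ : Set Formula // ¬ Der m Γ θ} := fun n =>
    n.rec ⟨∅, fun h => hθ h.provable⟩ fun n Γ => ⟨_, hcG Γ (ofCode n)⟩
  have hG : Monotone fun n => (G n).1 :=
    monotone_nat_of_le_succ fun n => Set.subset_insert _ _
  refine ⟨fun φ => c (G (code φ)) φ, ⋃ n, (G n).1, fun φ => hc _ _, fun φ => ?_, fun h => ?_⟩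
  · refine Set.mem_iUnion.2 ⟨code φ + 1, Or.inl ?_⟩
    rw [ofCode_code]
  · obtain ⟨n, hn⟩ := h.exists_of_iUnion hG
    exact (G n).2 hn

/-- Propositional completeness, with conditionals treated as atoms. -/
theorem provable_of_valid {θ : Formula} (h : ∀ v, IsVal m v → v θ = m - 1) :
    Provable m θ := by
  by_contra hθ
  obtain ⟨a, Γ, ha, hΓ, hd⟩ := exists_not_der hθ
  have := Der.extend ha hΓ θ
  rw [h _ (isVal_extend ha)] at this
  exact hd ((Der.thm (.desig θ)).mp this)

/-- Valuations under which all theorems are designated. -/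
structure IsCanonical (m : ℕ) (v : Formula → ℕ) : Prop extends IsVal m v where
  provable : ∀ θ, Provable m θ → v θ = m - 1

theorem provable_iff_canonical (hm : 2 ≤ m) {θ : Formula} :
    Provable m θ ↔ ∀ v, IsCanonical m v → v θ = m - 1 := by
  refine ⟨fun h v hv => hv.provable θ h, fun h => ?_⟩
  by_contra hθ
  obtain ⟨a, Γ, ha, hΓ, hd⟩ := exists_not_der hθ
  have hv := isVal_extend ha
  have hJ := Der.extend ha hΓ
  have key : ∀ φ, Der m Γ φ → extend m a φ = m - 1 := by
    intro φ hφ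
    by_contra hne
    -- If `φ` takes the given value, which is below the top, each of the `m - 1` implications raises
    -- the value by at least one until the top is reached; otherwise `J` is `0` and the inner
    -- implication is already at the top. So a derivable `φ` with a value below the top would make
    -- `θ` derivable.
    have taut : Provable m ((imp φ)^[m - 1] (imp (J m (extend m a φ) φ) θ)) := by
      refine provable_of_valid fun v hv' => ?_
      have h1 := hv'.le φ
      rw [hv'.iterate_imp, hv'.imp, hv'.J hm (hv.le φ), vimp]
      split_ifs with h2
      · have : (m - 1) * 1 ≤ (m - 1) * (m - 1 - v φ) :=
          Nat.mul_le_mul_left _ (by have := hv.le φ; omega)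
        omega
      · omega
    exact hd ((Der.of_iterate_imp (.thm taut) hφ).mp (hJ φ))
  have := hJ θ
  rw [h _ ⟨hv, fun φ hφ => key φ (.thm hφ)⟩] at this
  exact hd ((Der.thm (.desig θ)).mp this)

theorem IsVal.le_impChain {v : Formula → ℕ} (hv : IsVal m v) (f : ℕ → Formula)
    (ψ : Formula) (k : ℕ) : v ψ ≤ v (impChain f ψ k) := by
  induction k with
  | zero => exact le_rfl
  | succ k ih =>
    have h1 := hv.le (f (k + 1))
    have h2 := hv.le (impChain f ψ k)
    rw [impChain, hv.imp, vimp]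
    omega

theorem IsVal.impChain_eq_top {v : Formula → ℕ} (hv : IsVal m v) {f : ℕ → Formula}
    {ψ : Formula} {k i : ℕ} (h1 : 1 ≤ i) (hk : i ≤ k) (h : v (f i) ≤ v ψ) :
    v (impChain f ψ k) = m - 1 := by
  induction k with
  | zero => omega
  | succ k ih =>
    rw [impChain, hv.imp_eq_top]
    rcases Nat.lt_or_ge k i with h3 | h3
    · obtain rfl : i = k + 1 := by omega
      exact h.trans (hv.le_impChain f ψ k)
    · rw [ih h3]
      exact hv.le _

/-! ### Models and soundness -/

section Models

variable {W : Type*}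

open Classical in
/-- The value of a formula at a point of a model whose accessibility relations are indexed by
`m`-valued propositions. -/
noncomputable def eval (m : ℕ) (V : ℕ → W → ℕ) (R : (W → ℕ) → W → W → ℕ) : Formula → W → ℕ
  | .var n => fun w => V n w
  | .neg φ => fun w => m - 1 - eval m V R φ w
  | .imp φ ψ => fun w => vimp m (eval m V R φ w) (eval m V R ψ w)
  | .condl φ ψ => fun w =>
      Nat.findGreatest (fun k => ∀ u, k ≤ vimp m (R (eval m V R φ) w u) (eval m V R ψ u)) (m - 1)

variable {V : ℕ → W → ℕ} {R : (W → ℕ) → W → W → ℕ}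

open Classical in
theorem isVal_eval (hV : ∀ n w, V n w ≤ m - 1) (w : W) : IsVal m fun φ => eval m V R φ w where
  le φ := by
    cases φ with
    | var n => exact hV n w
    | neg φ => exact Nat.sub_le _ _
    | imp φ ψ => exact Nat.min_le_left _ _
    | condl φ ψ => exact Nat.findGreatest_le _
  neg _ := rfl
  imp _ _ := rfl

theorem le_eval_condl {k : ℕ} (hk : k ≤ m - 1) (φ ψ : Formula) (w : W) :
    k ≤ eval m V R (.condl φ ψ) w ↔
      ∀ u, k ≤ vimp m (R (eval m V R φ) w u) (eval m V R ψ u) := by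
  classical
  refine ⟨fun h u => h.trans ?_, fun h => ?_⟩
  · exact Nat.findGreatest_spec
      (P := fun k => ∀ u, k ≤ vimp m (R (eval m V R φ) w u) (eval m V R ψ u))
      (Nat.zero_le (m - 1)) (fun _ => Nat.zero_le _) u
  · exact Nat.le_findGreatest hk h

theorem eval_eq_top_of_provable (hm : 2 ≤ m) (hV : ∀ n w, V n w ≤ m - 1)
    (hR : ∀ X w u, R X w u ≤ m - 1) {θ : Formula} (h : Provable m θ) :
    ∀ w, eval m V R θ w = m - 1 := by
  have hval := isVal_eval (R := R) hV
  have hle := fun φ w => (hval w).le φ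
  have himp := fun φ ψ w => (hval w).imp_eq_top φ ψ
  have himp' := fun φ ψ w => (hval w).imp φ ψ
  have hconj := fun φ ψ w => (hval w).conj φ ψ
  have hbimp := fun φ ψ w => (hval w).bimp_eq_top φ ψ
  have hcond_conj : ∀ φ ψ θ w, eval m V R (.condl φ (conj ψ θ)) w =
      min (eval m V R (.condl φ ψ) w) (eval m V R (.condl φ θ) w) := by
    intro φ ψ θ w
    refine eq_of_forall_le_iff fun k => ?_
    rcases Nat.lt_or_ge (m - 1) k with hk | hk
    · have h1 := hle (.condl φ (conj ψ θ)) w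
      have h2 := hle (.condl φ ψ) w
      omega
    · rw [le_min_iff, le_eval_condl hk, le_eval_condl hk, le_eval_condl hk, ← forall_and]
      refine forall_congr' fun u => ?_
      simp only [hconj, vimp]
      omega
  induction h with
  | weak φ ψ =>
    intro w
    have h1 := hle φ w
    have h2 := hle ψ w
    simp only [himp', vimp] at *
    omega
  | perm φ ψ θ =>
    intro w
    have h1 := hle φ w
    have h2 := hle ψ w
    have h3 := hle θ w
    simp only [himp', vimp] at *
    omega
  | syll φ ψ θ =>
    intro w
    have h1 := hle φ w
    have h2 := hle ψ w
    have h3 := hle θ w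
    simp only [himp', vimp] at *
    omega
  | contr a ha φ ψ =>
    intro w
    have h1 := (hval w).J hm ha φ
    have h2 := hle ψ w
    simp only [himp', vimp] at *
    split_ifs at h1 <;> omega
  | cases φ ψ =>
    intro w
    have h1 := hle φ w
    have h2 := hle ψ w
    have h3 := (hval w).J hm h1 φ
    -- The index is shifted by one, so this antecedent is `J_a(φ) → ψ` for the actual value `a` of
    -- `φ`; it has the value of `ψ`.
    refine (hval w).impChain_eq_top (i := eval m V R φ w + 1) (by omega) ?_ ?_
    · omega
    · simp only [himp', vimp, Nat.add_sub_cancel, h3] at *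
      simp
  | desig φ =>
    intro w
    have h1 := (hval w).J hm le_rfl φ
    simp only [himp] at *
    split_ifs at h1 <;> omega
  | table_neg a ha φ =>
    intro w
    have h1 := (hval w).J hm ha φ
    have h2 := (hval w).J hm (Nat.sub_le (m - 1) a) (.neg φ)
    have h3 := (hval w).neg φ
    have h4 := hle φ w
    simp only [himp] at *
    split_ifs at h1 h2 <;> omega
  | table_imp a b ha hb φ ψ =>
    intro w
    have h1 := (hval w).J hm ha φ
    have h2 := (hval w).J hm hb ψ
    have h3 := (hval w).J hm (show vimp m a b ≤ m - 1 by rw [vimp]; omega) (.imp φ ψ)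
    have h4 := hle φ w
    have h5 := hle ψ w
    simp only [himp'] at h1 h2 h3 ⊢
    rw [h1, h2, h3]
    split_ifs with e1 e2 e3
    all_goals first | (simp only [vimp]; omega) | exact absurd (by rw [e1, e2]) e3
  | @mp φ ψ _ _ ih₁ ih₂ =>
    intro w
    have h1 := ih₁ w
    have h2 := ih₂ w
    have h3 := hle ψ w
    simp only [himp] at *
    omega
  | cm φ ψ θ =>
    intro w
    rw [himp, hcond_conj, hconj]
  | cc φ ψ θ =>
    intro w
    rw [himp, hcond_conj, hconj]
  | cn φ =>
    intro w
    refine le_antisymm (hle _ w) ((le_eval_condl le_rfl _ _ _).2 fun u => ?_)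
    have := (hval u).tt
    rw [this, vimp]
    omega
  | @rcea φ ψ θ _ ih =>
    intro w
    have : eval m V R φ = eval m V R ψ := funext fun u => (hbimp φ ψ u).1 (ih u)
    rw [hbimp]
    simp only [eval]
    rw [this]
  | @rcec φ ψ θ _ ih =>
    intro w
    have : eval m V R φ = eval m V R ψ := funext fun u => (hbimp φ ψ u).1 (ih u)
    rw [hbimp]
    simp only [eval]
    rw [this]
  | ra a ha φ γ γs _ ih =>
    intro w
    have h1 := (hval w).impChain_I hm ha (fun i => .condl φ (γs i)) (.condl φ γ)
      (f := fun i => m - i) (k := m) fun i h1 h2 => by omega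
    refine h1.trans (if_pos fun H => ?_)
    refine (le_eval_condl ha _ _ _).2 fun u => ?_
    -- Use the premise of the rule with `b` the degree of accessibility of `u`, and residuation: `a
    -- ⊙ b ≤ c` iff `a ≤ b → c`.
    have hr := hR (eval m V R φ) w u
    have h2 := ih _ hr u
    have h3 := (hval u).impChain_I hm (c := vodot m a (R (eval m V R φ) w u))
      (by rw [vodot]; omega) γs γ
      (f := fun i => vodot m (m - i) (R (eval m V R φ) w u)) (k := m)
      fun i h1 h2 => by rw [vodot]; omega
    beta_reduce at h3
    rw [h2] at h3
    split_ifs at h3 with h4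
    · have h5 := h4 fun i hi1 hi2 => by
        have := (le_eval_condl (show m - i ≤ m - 1 by omega) _ _ _).1 (H i hi1 hi2) u
        rw [vimp] at this
        rw [vodot]
        omega
      rw [vodot] at h5
      rw [vimp]
      omega
    · omega

end Models

/-! ### Witnesses for the values of conditionals -/

namespace Formula

/-- The conjunction of a list of formulae. -/
def bigConj : List Formula → Formula
  | [] => tt
  | φ :: L => conj φ (bigConj L)

end Formula

variable {v : Formula → ℕ}

theorem IsVal.le_bigConj (hv : IsVal m v) {L : List Formula} {k : ℕ} (h : k ≤ v (bigConj L)) :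
    ∀ φ ∈ L, k ≤ v φ := by
  induction L with
  | nil => simp
  | cons ψ L ih =>
    rw [bigConj, hv.conj, le_min_iff] at h
    exact List.forall_mem_cons.2 ⟨h.1, ih h.2⟩

theorem IsCanonical.condl_congr (hv : IsCanonical m v) {φ ψ : Formula}
    (h : Provable m (bimp φ ψ)) (θ : Formula) : v (.condl φ θ) = v (.condl ψ θ) :=
  (hv.bimp_eq_top _ _).1 (hv.provable _ (.rcea θ h))

theorem IsCanonical.le_condl_bigConj (hv : IsCanonical m v) {α : Formula} {L : List Formula}
    {k : ℕ} (hk : k ≤ m - 1) (h : ∀ φ ∈ L, k ≤ v (.condl α φ)) :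
    k ≤ v (.condl α (bigConj L)) := by
  induction L with
  | nil => rw [bigConj, hv.provable _ (.cn α)]; exact hk
  | cons ψ L ih =>
    rw [List.forall_mem_cons] at h
    have h1 := hv.provable _ (.cc α ψ (bigConj L))
    rw [hv.imp_eq_top, hv.conj] at h1
    exact (le_min h.1 (ih h.2)).trans h1

/-- If every `r ≤ m - 1` and every canonical valuation `u` satisfying the constraints that `v`
puts on an `r`-accessible point satisfy `c < (r → u β)`, then `c < v (α ≻ β)`. -/
theorem IsCanonical.lt_condl (hm : 2 ≤ m) (hv : IsCanonical m v) {α β : Formula}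
    {L : List Formula} {c : ℕ} (hc : c < m - 1)
    (h : ∀ u, IsCanonical m u → ∀ r ≤ m - 1,
      (∀ φ ∈ L, r ≤ vimp m (v (.condl α φ)) (u φ)) → c < vimp m r (u β)) :
    c < v (.condl α β) := by
  -- Group the formulae of `L` by the value of `α ≻ φ`, to match the thresholds of the rule `ra`;
  -- groups may be empty, and then `cn` applies. Residuation turns the assumption `h` into the
  -- premises of the rule.
  let γs : ℕ → Formula := fun i => bigConj (L.filter fun φ => v (.condl α φ) = m - i)
  have key := hv.provable _ (Provable.ra (m := m) (c + 1) hc α β γs fun b hb => by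
    refine (provable_iff_canonical hm).2 fun u hu => ?_
    rw [hu.impChain_I hm (by rw [vodot]; omega) _ _ fun i h1 h2 => by rw [vodot]; omega]
    refine if_pos fun H => ?_
    have := h u hu b hb fun φ hφ => by
      have h1 := hv.le (.condl α φ)
      have h2 := hu.le_bigConj (H (m - v (.condl α φ)) (by omega) (by omega)) φ
        (List.mem_filter.2 ⟨hφ, by simp only [decide_eq_true_eq]; omega⟩)
      rw [vodot] at h2
      rw [vimp]
      omega
    rw [vimp] at this
    rw [vodot]
    omega)
  rw [hv.impChain_I hm hc _ _ fun i h1 h2 => by omega] at key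
  split_ifs at key with h1
  · refine h1 fun i hi1 hi2 => hv.le_condl_bigConj (by omega) fun φ hφ => ?_
    have := (List.mem_filter.1 hφ).2
    simp only [decide_eq_true_eq] at this
    exact this.ge
  · omega

/-! ### Digits and codes of subformulae -/

/-- The `i`-th digit of `x` in base `b`. -/
def digit (b x i : ℕ) : ℕ := x / b ^ i % b

theorem digit_lt {b : ℕ} (hb : 0 < b) (x i : ℕ) : digit b x i < b := Nat.mod_lt _ hb

theorem exists_digits {b : ℕ} (f : ℕ → ℕ) (hf : ∀ i, f i < b) (K : ℕ) :
    ∃ x < b ^ K, ∀ i < K, digit b x i = f i := by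
  have hb : 0 < b := (Nat.zero_le _).trans_lt (hf 0)
  induction K with
  | zero => exact ⟨0, by simp, by simp⟩
  | succ K ih =>
    obtain ⟨x, hx, h⟩ := ih
    refine ⟨x + b ^ K * f K, ?_, fun i hi => ?_⟩
    · calc x + b ^ K * f K < b ^ K * (f K + 1) := by rw [Nat.mul_succ]; omega
        _ ≤ b ^ (K + 1) := by rw [pow_succ]; exact Nat.mul_le_mul_left _ (hf K)
    · rw [digit]
      rcases Nat.lt_succ_iff_lt_or_eq.1 hi with hi | rfl
      · obtain ⟨c, rfl⟩ : ∃ c, K = i + (c + 1) := ⟨K - i - 1, by omega⟩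
        -- The added term is a multiple of `b ^ (i + 1)`, so it leaves the `i`-th digit unchanged.
        rw [show b ^ (i + (c + 1)) * f (i + (c + 1)) = b ^ i * (b * (b ^ c * f (i + (c + 1)))) by
          ring, Nat.add_mul_div_left _ _ (Nat.pow_pos hb), Nat.add_mul_mod_self_left]
        exact h i hi
      · rw [Nat.add_mul_div_left _ _ (Nat.pow_pos hb), Nat.div_eq_of_lt hx, Nat.zero_add,
          Nat.mod_eq_of_lt (hf i)]

/-- The code of the left immediate subformula. -/
def left (n : ℕ) : ℕ := (n / 4).unpair.1

/-- The code of the right immediate subformula. -/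
def right (n : ℕ) : ℕ := (n / 4).unpair.2

theorem left_le (n : ℕ) : left n ≤ n := (Nat.unpair_left_le _).trans (Nat.div_le_self _ _)

theorem right_le (n : ℕ) : right n ≤ n := (Nat.unpair_right_le _).trans (Nat.div_le_self _ _)

theorem ofCode_neg {n : ℕ} (h : n % 4 = 1) : ofCode n = neg (ofCode (n / 4)) := by
  rw [ofCode, dif_neg (by omega), if_pos h]

theorem ofCode_imp {n : ℕ} (h : n % 4 = 2) :
    ofCode n = imp (ofCode (left n)) (ofCode (right n)) := by
  rw [ofCode, dif_neg (by omega), if_neg (by omega), if_pos h]; rfl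

theorem ofCode_condl {n : ℕ} (h : n % 4 = 3) :
    ofCode n = condl (ofCode (left n)) (ofCode (right n)) := by
  rw [ofCode, dif_neg (by omega), if_neg (by omega), if_neg (by omega)]; rfl

/-! ### Coded finite models

A number `x < m ^ N` codes, by its base `m` digits, an assignment of truth values to the formulae
with code less than `N`, and a number `y < 2 ^ (m ^ N)` codes a set of such assignments.
-/

/-- In the set coded by `y`, the antecedents of the conditionals `n` and `n'` always have the same
value. -/
def SameLeft (m N y n n' : ℕ) : Prop :=
  ∀ t < m ^ N, digit 2 y t = 1 → digit m t (left n) = digit m t (left n')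

/-- An assignment `z` may be accessible to the degree `r` from `x`, with respect to the antecedent
of the conditional `n`. -/
def Accessible (m N y x n z r : ℕ) : Prop :=
  ∀ n' < N, n' % 4 = 3 → SameLeft m N y n n' → r ≤ vimp m (digit m x n') (digit m z (right n'))

/-- The set coded by `y` contains a witness for the value that `x` gives to the conditional `n`. -/
def Witnessed (m N y x n : ℕ) : Prop :=
  ∃ z < m ^ N, digit 2 y z = 1 ∧ ∃ r < m,
    vimp m r (digit m z (right n)) ≤ digit m x n ∧ Accessible m N y x n z r

/-- The assignment `x` respects the connectives at the formula with code `n`. -/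
def Respects (m N y x n : ℕ) : Prop :=
  (n % 4 = 1 → digit m x n = m - 1 - digit m x (n / 4)) ∧
  (n % 4 = 2 → digit m x n = vimp m (digit m x (left n)) (digit m x (right n))) ∧
  (n % 4 = 3 → digit m x n = m - 1 ∨ Witnessed m N y x n)

/-- The number `y` codes a model for the formulae with code less than `N`. -/
def IsModel (m N y : ℕ) : Prop :=
  ∀ x < m ^ N, digit 2 y x = 1 → ∀ n < N, Respects m N y x n

/-- There is a model in which the formula with code `n` fails. -/
def Refutable (m n : ℕ) : Prop :=
  ∃ y < 2 ^ m ^ (n + 1), IsModel m (n + 1) y ∧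
    ∃ x < m ^ (n + 1), digit 2 y x = 1 ∧ digit m x n ≠ m - 1

/-- The coded assignments become the points of a model whose relation for `X` has the largest degree
allowed by all conditionals whose antecedent defines `X`. This choice bounds each conditional from
below by its digit, and witnesses bound it from above, so evaluation agrees with the digits and
soundness applies. -/
theorem not_provable_of_refutable (hm : 2 ≤ m) {φ : Formula} (h : Refutable m (code φ)) :
    ¬ Provable m φ := by
  classical
  obtain ⟨y, -, hy, x, hx, hxy, hφ⟩ := h
  generalize hN : code φ + 1 = N at hy hx
  have hd : ∀ x i, digit m x i ≤ m - 1 := fun x i => by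
    have := digit_lt (show 0 < m by omega) x i
    omega
  let W := {x // x < m ^ N ∧ digit 2 y x = 1}
  let V : ℕ → W → ℕ := fun p w => digit m w.1 (4 * p)
  let C : (W → ℕ) → W → W → ℕ → Prop := fun X w z r => ∀ n' < N, n' % 4 = 3 →
    (X = fun t => digit m t.1 (left n')) → r ≤ vimp m (digit m w.1 n') (digit m z.1 (right n'))
  let R : (W → ℕ) → W → W → ℕ := fun X w z => Nat.findGreatest (C X w z) (m - 1)
  have hR : ∀ X w z, R X w z ≤ m - 1 := fun X w z => Nat.findGreatest_le _
  have hC : ∀ X w z, C X w z (R X w z) := fun X w z =>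
    Nat.findGreatest_spec (P := C X w z) (Nat.zero_le (m - 1)) fun _ _ _ _ => Nat.zero_le _
  have truth : ∀ ψ, code ψ < N → ∀ w : W, eval m V R ψ w = digit m w.1 (code ψ) := by
    intro ψ
    induction ψ with
    | var p => exact fun _ w => rfl
    | neg ψ ih =>
      intro hψ w
      rw [code] at hψ ⊢
      rw [(hy w.1 w.2.1 w.2.2 _ hψ).1 (by omega), ← (show code ψ = (4 * code ψ + 1) / 4 by omega),
        ← ih (by omega) w]
      rfl
    | imp ψ χ ih₁ ih₂ =>
      intro hψ w
      have e1 : left (code (imp ψ χ)) = code ψ := by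
        rw [left, code, show ∀ a, (4 * a + 2) / 4 = a by intro a; omega, Nat.unpair_pair]
      have e2 : right (code (imp ψ χ)) = code χ := by
        rw [right, code, show ∀ a, (4 * a + 2) / 4 = a by intro a; omega, Nat.unpair_pair]
      rw [(hy w.1 w.2.1 w.2.2 _ hψ).2.1 (by rw [code]; omega), e1, e2,
        ← ih₁ ((e1 ▸ left_le _).trans_lt hψ) w, ← ih₂ ((e2 ▸ right_le _).trans_lt hψ) w]
      rfl
    | condl ψ χ ih₁ ih₂ =>
      intro hψ w
      have e0 : code (condl ψ χ) % 4 = 3 := by rw [code]; omega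
      have e1 : left (code (condl ψ χ)) = code ψ := by
        rw [left, code, show ∀ a, (4 * a + 3) / 4 = a by intro a; omega, Nat.unpair_pair]
      have e2 : right (code (condl ψ χ)) = code χ := by
        rw [right, code, show ∀ a, (4 * a + 3) / 4 = a by intro a; omega, Nat.unpair_pair]
      have i1 : eval m V R ψ = fun t => digit m t.1 (code ψ) :=
        funext (ih₁ ((e1 ▸ left_le _).trans_lt hψ))
      have i2 := ih₂ ((e2 ▸ right_le _).trans_lt hψ)
      refine le_antisymm ?_ ((le_eval_condl (hd _ _) _ _ _).2 fun u => ?_)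
      · rcases (hy w.1 w.2.1 w.2.2 _ hψ).2.2 e0 with h | ⟨z, hz, hzy, r, hr, hrz, hacc⟩
        · rw [h]
          exact (isVal_eval (R := R) (V := V) (fun _ _ => hd _ _) w).le _
        · have h1 := (le_eval_condl ((isVal_eval (R := R) (V := V) (fun _ _ => hd _ _) w).le _)
            ψ χ w).1 le_rfl ⟨z, hz, hzy⟩
          have h2 : r ≤ R (eval m V R ψ) w ⟨z, hz, hzy⟩ := by
            refine Nat.le_findGreatest (by omega) fun n' hn' h3 hX => hacc n' hn' h3 ?_
            intro t ht hty
            rw [i1] at hX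
            rw [e1]
            exact congrFun hX ⟨t, ht, hty⟩
          refine h1.trans (le_trans ?_ hrz)
          rw [i2, e2, vimp, vimp]
          dsimp only
          omega
      · have h1 := hC (eval m V R ψ) w u _ hψ e0 (by rw [i1, e1])
        have h2 := hd w.1 (code (condl ψ χ))
        have h3 := hR (eval m V R ψ) w u
        rw [e2] at h1
        rw [i2]
        rw [vimp] at h1 ⊢
        omega
  intro hprov
  have := eval_eq_top_of_provable hm (V := V) (fun _ _ => hd _ _) hR hprov ⟨x, hx, hxy⟩
  rw [truth φ (by omega)] at this
  exact hφ this

/-- Let `y` code the set of all restrictions of canonical valuations. Only the witnesses for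
conditionals below the top need an argument: without one, `lt_condl` would make the value of the
conditional exceed itself. -/
theorem refutable_of_not_provable (hm : 2 ≤ m) {φ : Formula} (h : ¬ Provable m φ) :
    Refutable m (code φ) := by
  classical
  rw [provable_iff_canonical hm] at h
  push Not at h
  obtain ⟨v₀, hv₀, hφ⟩ := h
  rw [Refutable]
  generalize hN : code φ + 1 = N
  have hdig : ∀ v, IsCanonical m v → ∃ x < m ^ N, ∀ i < N, digit m x i = v (ofCode i) :=
    fun v hv => exists_digits _ (fun i => by have := hv.le (ofCode i); omega) N
  obtain ⟨y, hy, hyS⟩ := exists_digits (b := 2)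
    (fun x => if ∃ v, IsCanonical m v ∧ ∀ i < N, digit m x i = v (ofCode i) then 1 else 0)
    (fun i => by split_ifs <;> omega) (m ^ N)
  have hmem : ∀ x < m ^ N, digit 2 y x = 1 ↔
      ∃ v, IsCanonical m v ∧ ∀ i < N, digit m x i = v (ofCode i) := by
    intro x hx
    rw [hyS x hx]
    split_ifs with h <;> simp [h]
  refine ⟨y, hy, fun x hx hxy n hn => ?_, ?_⟩
  · obtain ⟨v, hv, hxv⟩ := (hmem x hx).1 hxy
    have hl := (left_le n).trans_lt hn
    have hr := (right_le n).trans_lt hn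
    refine ⟨fun h => ?_, fun h => ?_, fun h => ?_⟩
    · rw [hxv n hn, hxv (n / 4) (by omega), ofCode_neg h, hv.neg]
    · rw [hxv n hn, hxv _ hl, hxv _ hr, ofCode_imp h, hv.imp]
    · by_contra! hcon
      obtain ⟨hne, hw⟩ := hcon
      rw [hxv n hn] at hne
      have hle := hv.le (ofCode n)
      refine lt_irrefl (v (ofCode n)) ?_
      conv_rhs => rw [ofCode_condl h]
      -- `L` lists the consequents of the conditionals that `Accessible` takes into account.
      refine hv.lt_condl hm (L := (List.range N).filterMap fun n' =>
        if n' % 4 = 3 ∧ SameLeft m N y n n' then some (ofCode (right n')) else none)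
        (by omega) fun u hu r hr' hL => ?_
      by_contra! hlt
      obtain ⟨z, hz, hzu⟩ := hdig u hu
      refine hw ⟨z, hz, (hmem z hz).2 ⟨u, hu, hzu⟩, r, by omega, ?_, fun n' hn' h3 hsame => ?_⟩
      · rw [hzu _ hr, hxv n hn]
        exact hlt
      · have hl' := (left_le n').trans_lt hn'
        have hr'' := (right_le n').trans_lt hn'
        -- Every canonical valuation restricts to a point of `y`, so antecedents that agree on `y`
        -- are provably equivalent and `rcea` allows exchanging them.
        have hb : Provable m (bimp (ofCode (left n)) (ofCode (left n'))) := by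
          refine (provable_iff_canonical hm).2 fun u' hu' => ?_
          obtain ⟨t, ht, htu⟩ := hdig u' hu'
          rw [hu'.bimp_eq_top, ← htu _ hl, ← htu _ hl']
          exact hsame t ht ((hmem t ht).2 ⟨u', hu', htu⟩)
        have := hL (ofCode (right n')) (List.mem_filterMap.2
          ⟨n', List.mem_range.2 hn', if_pos ⟨h3, hsame⟩⟩)
        rw [hv.condl_congr hb, ← ofCode_condl h3] at this
        rwa [hxv n' hn', hzu _ hr'']
  · obtain ⟨x, hx, hxv⟩ := hdig v₀ hv₀
    refine ⟨x, hx, (hmem x hx).2 ⟨v₀, hv₀, hxv⟩, ?_⟩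
    rwa [hxv _ (by omega), ofCode_code]

end LCR

namespace LCR

/-! ### Refutability is primitive recursive -/

open Primrec

section

variable {α : Type*} [Primcodable α]

theorem primrecPred_forall_lt {p : α → ℕ → Prop} {f : α → ℕ} (hf : Primrec f)
    (hp : PrimrecPred fun q : α × ℕ => p q.1 q.2) : PrimrecPred fun a => ∀ x < f a, p a x :=
  ((PrimrecRel.forall_mem_list (R := fun (x : ℕ) (a : α) => p a x)
    (hp.comp (Primrec.pair Primrec.snd Primrec.fst))).comp (list_range.comp hf)
      Primrec.id).of_eq fun a => by simp

theorem primrecPred_exists_lt {p : α → ℕ → Prop} {f : α → ℕ} (hf : Primrec f)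
    (hp : PrimrecPred fun q : α × ℕ => p q.1 q.2) : PrimrecPred fun a => ∃ x < f a, p a x :=
  ((PrimrecRel.exists_mem_list (R := fun (x : ℕ) (a : α) => p a x)
    (hp.comp (Primrec.pair Primrec.snd Primrec.fst))).comp (list_range.comp hf)
      Primrec.id).of_eq fun a => by simp

theorem primrecPred_imp {p q : α → Prop} (hp : PrimrecPred p) (hq : PrimrecPred q) :
    PrimrecPred fun a => p a → q a := by
  classical
  exact (hp.not.or hq).of_eq fun a => (imp_iff_not_or).symm

theorem primrec_pow {f g : α → ℕ} (hf : Primrec f) (hg : Primrec g) :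
    Primrec fun a => f a ^ g a := by
  have h : Primrec₂ ((· ^ ·) : ℕ → ℕ → ℕ) :=
    (Primrec.nat_rec (f := fun _ : ℕ => 1) (g := fun (b : ℕ) (q : ℕ × ℕ) => q.2 * b) (.const 1)
      (nat_mul.comp (snd.comp snd) fst)).of_eq fun b n => by
        induction n with
        | zero => rfl
        | succ n ih => rw [pow_succ, ← ih]
  exact h.comp hf hg

theorem primrec_digit {b f g : α → ℕ} (hb : Primrec b) (hf : Primrec f) (hg : Primrec g) :
    Primrec fun a => digit (b a) (f a) (g a) :=
  nat_mod.comp (nat_div.comp hf (primrec_pow hb hg)) hb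

theorem primrec_vimp (m : ℕ) {f g : α → ℕ} (hf : Primrec f) (hg : Primrec g) :
    Primrec fun a => vimp m (f a) (g a) :=
  nat_min.comp (.const _) (nat_add.comp (nat_sub.comp (.const _) hf) hg)

theorem primrec_left {f : α → ℕ} (hf : Primrec f) : Primrec fun a => left (f a) :=
  fst.comp (unpair.comp (nat_div.comp hf (.const 4)))

theorem primrec_right {f : α → ℕ} (hf : Primrec f) : Primrec fun a => right (f a) :=
  snd.comp (unpair.comp (nat_div.comp hf (.const 4)))

theorem primrecPred_mod_four {f : α → ℕ} (hf : Primrec f) (k : ℕ) :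
    PrimrecPred fun a => f a % 4 = k :=
  Primrec.eq.comp (nat_mod.comp hf (.const 4)) (.const k)

theorem primrecPred_bit {f g : α → ℕ} (hf : Primrec f) (hg : Primrec g) :
    PrimrecPred fun a => digit 2 (f a) (g a) = 1 :=
  Primrec.eq.comp (primrec_digit (.const 2) hf hg) (.const 1)

variable (m : ℕ) {N y x n n' z r : α → ℕ}

theorem primrecPred_sameLeft (hN : Primrec N) (hy : Primrec y) (hn : Primrec n)
    (hn' : Primrec n') : PrimrecPred fun a => SameLeft m (N a) (y a) (n a) (n' a) :=
  primrecPred_forall_lt (primrec_pow (.const m) hN)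
    (primrecPred_imp (primrecPred_bit (hy.comp fst) snd)
      (Primrec.eq.comp (primrec_digit (.const m) snd (primrec_left (hn.comp fst)))
        (primrec_digit (.const m) snd (primrec_left (hn'.comp fst)))))

theorem primrecPred_accessible (hN : Primrec N) (hy : Primrec y) (hx : Primrec x)
    (hn : Primrec n) (hz : Primrec z) (hr : Primrec r) :
    PrimrecPred fun a => Accessible m (N a) (y a) (x a) (n a) (z a) (r a) :=
  primrecPred_forall_lt hN
    (primrecPred_imp (primrecPred_mod_four snd 3)
      (primrecPred_imp
        (primrecPred_sameLeft m (hN.comp fst) (hy.comp fst) (hn.comp fst) snd)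
        (nat_le.comp (hr.comp fst) (primrec_vimp m (primrec_digit (.const m) (hx.comp fst) snd)
          (primrec_digit (.const m) (hz.comp fst) (primrec_right snd))))))

theorem primrecPred_witnessed (hN : Primrec N) (hy : Primrec y) (hx : Primrec x)
    (hn : Primrec n) : PrimrecPred fun a => Witnessed m (N a) (y a) (x a) (n a) :=
  primrecPred_exists_lt (primrec_pow (.const m) hN)
    ((primrecPred_bit (hy.comp fst) snd).and
      (primrecPred_exists_lt (.const m)
        ((nat_le.comp
          (primrec_vimp m snd (primrec_digit (.const m) (snd.comp fst)
            (primrec_right (hn.comp (fst.comp fst)))))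
          (primrec_digit (.const m) (hx.comp (fst.comp fst)) (hn.comp (fst.comp fst)))).and
        (primrecPred_accessible m (hN.comp (fst.comp fst)) (hy.comp (fst.comp fst))
          (hx.comp (fst.comp fst)) (hn.comp (fst.comp fst)) (snd.comp fst) snd))))

theorem primrecPred_respects (hN : Primrec N) (hy : Primrec y) (hx : Primrec x)
    (hn : Primrec n) : PrimrecPred fun a => Respects m (N a) (y a) (x a) (n a) :=
  have hd := primrec_digit (.const m) hx hn
  (primrecPred_imp (primrecPred_mod_four hn 1)
    (Primrec.eq.comp hd (nat_sub.comp (.const (m - 1))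
      (primrec_digit (.const m) hx (nat_div.comp hn (.const 4)))))).and
  ((primrecPred_imp (primrecPred_mod_four hn 2)
    (Primrec.eq.comp hd (primrec_vimp m (primrec_digit (.const m) hx (primrec_left hn))
      (primrec_digit (.const m) hx (primrec_right hn))))).and
  (primrecPred_imp (primrecPred_mod_four hn 3)
    ((Primrec.eq.comp hd (.const (m - 1))).or (primrecPred_witnessed m hN hy hx hn))))

theorem primrecPred_isModel (hN : Primrec N) (hy : Primrec y) :
    PrimrecPred fun a => IsModel m (N a) (y a) :=
  primrecPred_forall_lt (primrec_pow (.const m) hN)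
    (primrecPred_imp (primrecPred_bit (hy.comp fst) snd)
      (primrecPred_forall_lt (hN.comp fst)
        (primrecPred_respects m (hN.comp (fst.comp fst)) (hy.comp (fst.comp fst)) (snd.comp fst)
          snd)))

theorem primrecPred_refutable (hn : Primrec n) : PrimrecPred fun a => Refutable m (n a) :=
  have hN := succ.comp hn
  primrecPred_exists_lt (primrec_pow (.const 2) (primrec_pow (.const m) hN))
    ((primrecPred_isModel m (hN.comp fst) snd).and
      (primrecPred_exists_lt (primrec_pow (.const m) (hN.comp fst))
        ((primrecPred_bit (snd.comp fst) snd).and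
          (Primrec.eq.comp (primrec_digit (.const m) snd (hn.comp (fst.comp fst)))
            (.const (m - 1))).not)))

end

theorem primrec_code : Primrec Formula.code := Primrec.of_equiv (e := Formula.codeEquiv)

end LCR

theorem corollary3p5 (m : ℕ) (hm : 2 ≤ m) :
    ComputablePred (fun φ : LCR.Formula => LCR.Provable m φ) :=
  ((LCR.primrecPred_refutable m LCR.primrec_code).not.of_eq fun _ =>
    ⟨fun h => by_contra fun h' => h (LCR.refutable_of_not_provable hm h'),
      fun h h' => LCR.not_provable_of_refutable hm h' h⟩).computablePred
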